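/- Let $F$ be a field, $V$ a finite-dimensional $F$-vector space and $C\subseteq V\otimes V$ a subspace. Let $U=T(V)/(C)$ be the corresponding quadratic algebra, and let $U^!=T(V^*)/(C^{\perp})$ be its quadratic dual, where $C^{\perp}\subseteq V^*\otimes V^*$ is the annihilator of $C$ for the pairing $\langle f\otimes g,\,v\otimes w\rangle=f(v)g(w)$. Write $U^!_p$ for the component of degree $p$ of $U^!$, and regard $F$ as a left $U$-module through the augmentation $\varepsilon:U\to F$ that kills $V$. Suppose that $\mathrm{Ext}_U(F,F)=U^!$, in the sense that for every $p\ge 0$ the $F$-vector spaces $\mathrm{Ext}^p_U(F,F)$ and $U^!_p$ are isomorphic (in particular this holds if $\mathrm{Ext}_U^{\bullet}(F,F)\cong U^!$ as graded algebras). Then $U$ is a Koszul algebra, i.e. its augmented Koszul complex $$\cdots\to U\otimes (U^!_2)^*\to U\otimes (U^!_1)^*\to U\otimes (U^!_0)^*\to F\to 0$$ is exact. Here the differential is $u\otimes f\mapsto\sum_i u e_i\otimes f(e^i\,\cdot\,)$, where $(e_i)$ is a basis of $V$ with dual basis $(e^i)$ (it does not depend on the basis), and the last map is $u\otimes f\mapsto\varepsilon(u)f(1)$.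 -/

import Mathlib

open scoped TensorProduct

universe u

namespace QuadraticAlg

noncomputable section

variable {F : Type u} [Field F] {V : Type u} [AddCommGroup V] [Module F V]

/-- The embedding of `V ⊗ V` into the tensor algebra, `v ⊗ w ↦ v w`. -/
def ofTensorSq (F : Type u) [Field F] (V : Type u) [AddCommGroup V] [Module F V] :
    V ⊗[F] V →ₗ[F] TensorAlgebra F V :=
  LinearMap.mul' F (TensorAlgebra F V) ∘ₗ
    TensorProduct.map (TensorAlgebra.ι F) (TensorAlgebra.ι F)

/-- The quadratic algebra `T(V)/(C)`: the quotient of the tensor algebra by the two-sided ideal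
generated by the subspace `C` of `V ⊗ V`. -/
def Alg (C : Submodule F (V ⊗[F] V)) : Type u :=
  TensorAlgebra F V ⧸ (TwoSidedIdeal.span (ofTensorSq F V '' C)).asIdeal

instance (C : Submodule F (V ⊗[F] V)) : Ring (Alg C) :=
  inferInstanceAs (Ring (TensorAlgebra F V ⧸ (TwoSidedIdeal.span (ofTensorSq F V '' C)).asIdeal))

instance (C : Submodule F (V ⊗[F] V)) : Algebra F (Alg C) :=
  inferInstanceAs
    (Algebra F (TensorAlgebra F V ⧸ (TwoSidedIdeal.span (ofTensorSq F V '' C)).asIdeal))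

/-- The quotient map `T(V) → T(V)/(C)`. -/
def mk (C : Submodule F (V ⊗[F] V)) : TensorAlgebra F V →ₐ[F] Alg C :=
  Ideal.Quotient.mkₐ F (TwoSidedIdeal.span (ofTensorSq F V '' C)).asIdeal

/-- The canonical map from `V` to `T(V)/(C)`. -/
def gen (C : Submodule F (V ⊗[F] V)) : V →ₗ[F] Alg C :=
  (mk C).toLinearMap ∘ₗ TensorAlgebra.ι F

/-- The component of degree `p` of `T(V)/(C)`, spanned by the `p`-fold products of
elements of `V`. -/
def piece (C : Submodule F (V ⊗[F] V)) (p : ℕ) : Submodule F (Alg C) :=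
  LinearMap.range (gen C) ^ p

/-- The annihilator of `C` in `V* ⊗ V*`, for the pairing
`⟨f ⊗ g, v ⊗ w⟩ = f v * g w`. The quadratic dual of `T(V)/(C)` is `Alg (perp C)`. -/
def perp (C : Submodule F (V ⊗[F] V)) :
    Submodule F (Module.Dual F V ⊗[F] Module.Dual F V) :=
  C.dualAnnihilator.comap (TensorProduct.dualDistrib F V V)

theorem algebraMapInv_ofTensorSq (c : V ⊗[F] V) :
    TensorAlgebra.algebraMapInv (ofTensorSq F V c) = 0 := by
  induction c with
  | zero => simp
  | tmul v w => simp [ofTensorSq, TensorAlgebra.algebraMapInv]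
  | add a b ha hb => simp [ha, hb]

/-- The augmentation `T(V)/(C) → F`, which kills `V`. -/
def aug (C : Submodule F (V ⊗[F] V)) : Alg C →ₐ[F] F :=
  Ideal.Quotient.liftₐ (TwoSidedIdeal.span (ofTensorSq F V '' C)).asIdeal
    TensorAlgebra.algebraMapInv fun a ha => by
    rw [← TwoSidedIdeal.mem_ker]
    refine TwoSidedIdeal.span_le.mpr ?_ (TwoSidedIdeal.mem_asIdeal.mp ha)
    rintro _ ⟨c, -, rfl⟩
    exact (TwoSidedIdeal.mem_ker _).mpr (algebraMapInv_ofTensorSq c)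

/-- The field `F` as a left module over `U = T(V)/(C)` through the augmentation. -/
abbrev trivialModule (C : Submodule F (V ⊗[F] V)) : ModuleCat.{u} (Alg C) :=
  (ModuleCat.restrictScalars (aug C).toRingHom).obj (ModuleCat.of F F)

/-- The vector space `Ext_U^p(F, F)` for `U = T(V)/(C)`, taken in the category of all left
`U`-modules. -/
abbrev extFF (C : Submodule F (V ⊗[F] V)) (p : ℕ) : ModuleCat.{u} F :=
  ((Ext F (ModuleCat.{u} (Alg C)) p).obj (Opposite.op (trivialModule C))).obj (trivialModule C)

/-- Left multiplication by a generator, from the component of degree `p` to that of degree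
`p + 1`. -/
def genMul (C : Submodule F (V ⊗[F] V)) (v : V) (p : ℕ) :
    piece C p →ₗ[F] piece C (p + 1) :=
  (LinearMap.mulLeft F (gen C v)).restrict fun x hx => by
    rw [piece, pow_succ']
    exact Submodule.mul_mem_mul (LinearMap.mem_range_self _ v) hx

theorem one_mem_piece_zero (C : Submodule F (V ⊗[F] V)) : (1 : Alg C) ∈ piece C 0 := by
  rw [piece, pow_zero]
  exact Submodule.one_le.mp le_rfl

/-- The term `U ⊗ (U^!_p)*` of the Koszul complex of `U = T(V)/(C)`. -/
abbrev koszulX (C : Submodule F (V ⊗[F] V)) (p : ℕ) : Type u :=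
  Alg C ⊗[F] Module.Dual F (piece (perp C) p)

/-- The differential `U ⊗ (U^!_{p+1})* → U ⊗ (U^!_p)*` of the Koszul complex, dual to the left
multiplication by the canonical element `∑ i, eᵢ ⊗ eⁱ` of `V ⊗ V*`:
it sends `u ⊗ f` to `∑ i, u eᵢ ⊗ f (eⁱ · _)`, where `(eᵢ)` is a basis of `V` with dual basis
`(eⁱ)`. It does not depend on the choice of the basis. -/
def koszulD [FiniteDimensional F V] (C : Submodule F (V ⊗[F] V)) (p : ℕ) :
    koszulX C (p + 1) →ₗ[Alg C] koszulX C p :=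
  ∑ i, TensorProduct.AlgebraTensorModule.map
    (LinearMap.toSpanSingleton (Alg C) (Alg C) (gen C (Module.finBasis F V i)))
    (genMul (perp C) ((Module.finBasis F V).coord i) p).dualMap

/-- The augmentation `U ⊗ (U^!_0)* → F` of the Koszul complex, `u ⊗ f ↦ ε(u) f(1)`. -/
def koszulAug (C : Submodule F (V ⊗[F] V)) : koszulX C 0 →ₗ[F] F :=
  LinearMap.mul' F F ∘ₗ TensorProduct.map (aug C).toLinearMap
    (Module.Dual.eval F (piece (perp C) 0) ⟨1, one_mem_piece_zero (perp C)⟩)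

/-- `U = T(V)/(C)` is a Koszul algebra: its augmented Koszul complex
`⋯ → U ⊗ (U^!_2)* → U ⊗ (U^!_1)* → U ⊗ (U^!_0)* → F → 0` is exact. -/
def IsKoszul [FiniteDimensional F V] (C : Submodule F (V ⊗[F] V)) : Prop :=
  (∀ p, Function.Exact (koszulD C (p + 1)) (koszulD C p)) ∧
    Function.Exact (koszulD C 0) (koszulAug C) ∧
    Function.Surjective (koszulAug C)

end

end QuadraticAlg

/-!
Let `U = T(V)/(C)`, let `U^!` be its quadratic dual and let `K_p = U ⊗ (U^!_p)*`. The proof shows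
by induction on `p` that the cycles `Z_p` of the augmented Koszul complex are boundaries.

If the complex is exact below degree `p`, then `Z_p` is the `(p + 1)`-st syzygy of `F` in the start
`K_p → ⋯ → K_0 → F` of a projective resolution. The complex is minimal (`aug_of_mem_cycles`): its
differential raises the internal degree, given by the grading of `U`, and is injective on the part
`(U^!_p)*` of internal degree zero, so `Z_p` lies in positive internal degrees and every
homomorphism `K_p → F` kills it. Hence dimension shifting embeds `Hom_U(Z_p, F)` into
`Ext_U^(p + 1)(F, F)` (`exists_hom_to_ext`), and by hypothesis
`dim Hom_U(Z_p, F) ≤ dim U^!_(p + 1)`.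

On the other hand the part of `Z_p` of internal degree one is exactly the image of
`(U^!_(p + 1))*`, because the relations of `U^!` are the annihilator of those of `U`
(`exists_kHomD_kHomConst_eq`). Every linear form on it, extended by zero to the other internal
degrees, is a homomorphism `Z_p → F`; this already gives `dim U^!_(p + 1)` independent
homomorphisms, so there are no others. If some cycle were not a boundary, then the lowest
internal degree `j` in which this happens would be at least two, and a linear form on the degree `j`
part vanishing on the boundaries would be one more homomorphism `Z_p → F`, a contradiction
(`exists_kHomD_eq_of_injective`).

What is needed about the low degree components of a quadratic algebra `T(V)/(C)` is contained in
`exists_linearMap_gen_mul`: a family of linear maps `g v` on it is of the form `a ↦ f (v a)` as soon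
as it is compatible with the relations. The terms `K_p` are handled as spaces of
linear maps `U^!_p → U`, with `(u h) y = u (h y)` and `(d h) y = ∑ i, h (eⁱ y) eᵢ`.
-/

namespace QuadraticAlg

noncomputable section

/-! ### Maps out of a quadratic algebra -/

section

variable {F : Type u} [Field F] {V : Type u} [AddCommGroup V] [Module F V]

/-- The product `v ⊗ w ↦ φ v * φ w` of a linear map `φ` into an algebra with itself. -/
def mulSq {B : Type*} [Ring B] [Algebra F B] (φ : V →ₗ[F] B) : V ⊗[F] V →ₗ[F] B :=
  LinearMap.mul' F B ∘ₗ TensorProduct.map φ φ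

@[simp]
theorem mulSq_tmul {B : Type*} [Ring B] [Algebra F B] (φ : V →ₗ[F] B) (v w : V) :
    mulSq φ (v ⊗ₜ w) = φ v * φ w := by
  simp [mulSq]

theorem algHom_ofTensorSq {B : Type*} [Ring B] [Algebra F B] (g : TensorAlgebra F V →ₐ[F] B)
    (c : V ⊗[F] V) :
    g (ofTensorSq F V c) = mulSq (g.toLinearMap ∘ₗ TensorAlgebra.ι F) c := by
  induction c with
  | zero => simp
  | tmul v w => simp [ofTensorSq]
  | add a b ha hb => simp [ha, hb]

variable (C : Submodule F (V ⊗[F] V))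

/-- The universal property of `T(V)/(C)`: a linear map `φ` into an algebra such that `φ ⊗ φ`
kills `C` extends to an algebra homomorphism. -/
def lift {B : Type*} [Ring B] [Algebra F B] (φ : V →ₗ[F] B) (h : ∀ c ∈ C, mulSq φ c = 0) :
    Alg C →ₐ[F] B :=
  Ideal.Quotient.liftₐ (TwoSidedIdeal.span (ofTensorSq F V '' C)).asIdeal
    (TensorAlgebra.lift F φ) fun a ha => by
    rw [← TwoSidedIdeal.mem_ker]
    refine TwoSidedIdeal.span_le.mpr ?_ (TwoSidedIdeal.mem_asIdeal.mp ha)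
    rintro _ ⟨c, hc, rfl⟩
    refine (TwoSidedIdeal.mem_ker _).mpr ?_
    rw [algHom_ofTensorSq, ← h c hc]
    congr 2
    ext v
    simp

variable {C}

@[simp]
theorem lift_gen {B : Type*} [Ring B] [Algebra F B] (φ : V →ₗ[F] B)
    (h : ∀ c ∈ C, mulSq φ c = 0) (v : V) : lift C φ h (gen C v) = φ v := by
  change TensorAlgebra.lift F φ (TensorAlgebra.ι F v) = φ v
  simp

@[simp]
theorem aug_gen (v : V) : aug C (gen C v) = 0 := by
  change TensorAlgebra.algebraMapInv (TensorAlgebra.ι F v) = 0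
  simp [TensorAlgebra.algebraMapInv]

theorem mk_surjective : Function.Surjective (mk C) :=
  Ideal.Quotient.mk_surjective

theorem mulSq_gen_eq_zero {c : V ⊗[F] V} (hc : c ∈ C) : mulSq (gen C) c = 0 := by
  rw [gen, ← algHom_ofTensorSq]
  exact Ideal.Quotient.eq_zero_iff_mem.mpr
    (TwoSidedIdeal.mem_asIdeal.mpr (TwoSidedIdeal.subset_span ⟨c, hc, rfl⟩))

theorem algHom_ext {B : Type*} [Ring B] [Algebra F B] {f g : Alg C →ₐ[F] B}
    (h : ∀ v, f (gen C v) = g (gen C v)) : f = g := by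
  have h' : f.comp (mk C) = g.comp (mk C) := by
    ext v
    exact h v
  ext x
  obtain ⟨x, rfl⟩ := mk_surjective x
  exact DFunLike.congr_fun h' x

/-- Induction on an element of `T(V)/(C)`, which is spanned by the words in the generators. -/
@[elab_as_elim]
theorem alg_induction {P : Alg C → Prop} (one : P 1) (gen_mul : ∀ v x, P x → P (gen C v * x))
    (add : ∀ x y, P x → P y → P (x + y)) (smul : ∀ (r : F) x, P x → P (r • x)) (x : Alg C) :
    P x := by
  obtain ⟨x, rfl⟩ := mk_surjective x
  suffices H : ∀ y, P y → P (mk C x * y) by simpa using H 1 one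
  induction x using TensorAlgebra.induction with
  | algebraMap r => intro y hy; simpa [Algebra.smul_def] using smul r y hy
  | ι v => exact fun y hy => gen_mul v y hy
  | mul a b ha hb => intro y hy; rw [map_mul, mul_assoc]; exact ha _ (hb _ hy)
  | add a b ha hb => intro y hy; rw [map_add, add_mul]; exact add _ _ (ha _ hy) (hb _ hy)

/-- A family of linear maps `g v` on `T(V)/(C)` can be integrated to a linear map `f` with
`f (v a) = g v a` as soon as it is compatible with the relations, that is, `∑ g v (w a) = 0` for all
`∑ v ⊗ w` in `C` and all `a`. The map `f` is read off from
the action of `T(V)/(C)` on `T(V)/(C) × N` in which `v` sends `(a, s)` to `(v a, g v a)`. -/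
theorem exists_linearMap_gen_mul {N : Type*} [AddCommGroup N] [Module F N]
    (g : V →ₗ[F] Alg C →ₗ[F] N)
    (h : ∀ c ∈ C, ∀ a, TensorProduct.lift
      ((LinearMap.lcomp F N ((LinearMap.mul F (Alg C)).flip a ∘ₗ gen C)) ∘ₗ g) c = 0) :
    ∃ f : Alg C →ₗ[F] N, ∀ v a, f (gen C v * a) = g v a := by
  let φ : V →ₗ[F] Module.End F (Alg C × N) :=
    { toFun := fun v => ((LinearMap.mulLeft F (gen C v)).prod (g v)) ∘ₗ LinearMap.fst F _ _
      map_add' := fun v w => by ext <;> simp [add_mul]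
      map_smul' := fun r v => by ext <;> simp }
  have hφ : ∀ c (x : Alg C × N), mulSq φ c x =
      (mulSq (gen C) c * x.1, TensorProduct.lift
        ((LinearMap.lcomp F N ((LinearMap.mul F (Alg C)).flip x.1 ∘ₗ gen C)) ∘ₗ g) c) := by
    intro c x
    induction c with
    | zero => simp [Prod.mk_zero_zero]
    | tmul v w => simp [φ, mul_assoc]
    | add a b ha hb =>
      rw [map_add, LinearMap.add_apply, ha, hb]
      simp [add_mul]
  let Φ := lift C φ fun c hc => by
    refine LinearMap.ext fun x => ?_
    rw [hφ, h c hc, mulSq_gen_eq_zero hc]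
    simp
  have hΦ : ∀ v x, Φ (gen C v * x) (1, 0) = φ v (Φ x (1, 0)) := fun v x => by
    simp only [Φ, map_mul, lift_gen, Module.End.mul_apply]
  have hfst : ∀ x, (Φ x (1, 0)).1 = x := fun x => by
    induction x using alg_induction with
    | one => simp
    | gen_mul v x hx => rw [hΦ]; simp [φ, hx]
    | add x y hx hy => simp [hx, hy]
    | smul r x hx => simp [hx]
  refine ⟨LinearMap.snd F _ _ ∘ₗ LinearMap.applyₗ (1, 0) ∘ₗ Φ.toLinearMap, fun v a => ?_⟩
  change (Φ (gen C v * a) (1, 0)).2 = g v a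
  rw [hΦ]
  simp [φ, hfst]

variable (C) in
/-- The component of degree one of `T(V)/(C)` is `V`: some linear map `T(V)/(C) → V` is the
identity on the generators and zero on the words of length at least two. -/
theorem exists_degreeOne :
    ∃ f : Alg C →ₗ[F] V, ∀ v a, f (gen C v * a) = aug C a • v := by
  obtain ⟨f, hf⟩ := exists_linearMap_gen_mul (C := C)
    ((LinearMap.lsmul F V ∘ₗ (aug C).toLinearMap).flip) (fun c _ a => by
      convert LinearMap.zero_apply (σ₁₂ := RingHom.id F) c
      ext v w
      simp)
  exact ⟨f, fun v a => by simp [hf]⟩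

theorem gen_injective : Function.Injective (gen C) := by
  obtain ⟨π, hπ⟩ := exists_degreeOne C
  refine Function.LeftInverse.injective (g := π) fun v => ?_
  simpa using hπ v 1

/-- The component of degree two of `T(V)/(C)` is `(V ⊗ V) / C`, in terms of functionals: those on
`V ⊗ V` that vanish on `C` come from `T(V)/(C)`. -/
theorem exists_functional_mulSq (ρ : Module.Dual F (V ⊗[F] V)) (hρ : ∀ c ∈ C, ρ c = 0) :
    ∃ f : Module.Dual F (Alg C), ∀ c, f (mulSq (gen C) c) = ρ c := by
  obtain ⟨π, hπ⟩ := exists_degreeOne C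
  have key : ∀ (a : Alg C) (c : V ⊗[F] V), TensorProduct.lift
      ((LinearMap.lcomp F F ((LinearMap.mul F (Alg C)).flip a ∘ₗ gen C)) ∘ₗ
        (LinearMap.lcomp F F π ∘ₗ TensorProduct.curry ρ)) c = aug C a * ρ c := by
    intro a c
    induction c with
    | zero => simp
    | tmul v w => simp [hπ]
    | add x y hx hy => rw [map_add, hx, hy, map_add, mul_add]
  obtain ⟨f, hf⟩ := exists_linearMap_gen_mul (C := C)
    (LinearMap.lcomp F F π ∘ₗ TensorProduct.curry ρ) (fun c hc a => by rw [key, hρ c hc, mul_zero])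
  refine ⟨f, fun c => ?_⟩
  induction c with
  | zero => simp
  | tmul v w => simpa [hf] using congrArg (fun x => ρ (v ⊗ₜ x)) (hπ w 1)
  | add x y hx hy => simp [hx, hy]

/-! ### The grading -/

theorem gen_mem_piece (v : V) : gen C v ∈ piece C 1 := by
  rw [piece, pow_one]
  exact LinearMap.mem_range_self _ v

instance : SetLike.GradedMonoid (piece C) :=
  inferInstanceAs (SetLike.GradedMonoid (LinearMap.range (gen C) ^ ·))

open scoped DirectSum

variable (C) in
/-- The inclusion of the generators into the direct sum of the components. -/
def genDirectSum : V →ₗ[F] ⨁ i, piece C i :=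
  DirectSum.lof F ℕ (fun i => piece C i) 1 ∘ₗ (gen C).codRestrict _ gen_mem_piece

theorem genDirectSum_apply (v : V) :
    genDirectSum C v = DirectSum.of (fun i => piece C i) 1 ⟨gen C v, gen_mem_piece v⟩ :=
  rfl

theorem mulSq_genDirectSum_eq_zero {c : V ⊗[F] V} (hc : c ∈ C) :
    mulSq (B := ⨁ i, piece C i) (genDirectSum C) c = 0 := by
  have hmem : ∀ x : V ⊗[F] V, mulSq (gen C) x ∈ piece C 2 := fun x => by
    induction x with
    | zero => simp
    | tmul v w =>
      rw [mulSq_tmul]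
      exact SetLike.mul_mem_graded (A := piece C) (gen_mem_piece v) (gen_mem_piece w)
    | add x y hx hy => rw [map_add]; exact add_mem hx hy
  have key : ∀ x : V ⊗[F] V, mulSq (B := ⨁ i, piece C i) (genDirectSum C) x =
      DirectSum.of (fun i => piece C i) 2 ⟨mulSq (gen C) x, hmem x⟩ := fun x => by
    induction x with
    | zero =>
      rw [map_zero, eq_comm]
      convert map_zero (DirectSum.of (fun i => piece C i) 2)
      simp
    | tmul v w =>
      rw [mulSq_tmul, genDirectSum_apply, genDirectSum_apply, DirectSum.of_mul_of]
      exact DirectSum.of_eq_of_gradedMonoid_eq (Sigma.subtype_ext rfl (mulSq_tmul _ v w).symm)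
    | add x y hx hy =>
      rw [map_add, hx, hy, ← map_add]
      congr 1
      ext
      simp
  rw [key, ← map_zero (DirectSum.of (fun i => piece C i) 2)]
  congr 1
  ext
  simpa using mulSq_gen_eq_zero hc

variable (C) in
/-- The decomposition of an element of `T(V)/(C)` into its homogeneous components. -/
def toDirectSum : Alg C →ₐ[F] ⨁ i, piece C i :=
  lift (B := ⨁ i, piece C i) C (genDirectSum C) fun _ hc => mulSq_genDirectSum_eq_zero hc

theorem toDirectSum_gen (v : V) :
    toDirectSum C (gen C v) =
      DirectSum.of (fun i => piece C i) 1 ⟨gen C v, gen_mem_piece v⟩ :=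
  lift_gen (B := ⨁ i, piece C i) _ _ v

theorem toDirectSum_of_mem {i : ℕ} {x : Alg C} (hx : x ∈ piece C i) :
    toDirectSum C x = DirectSum.of (fun i => piece C i) i ⟨x, hx⟩ := by
  induction hx using Submodule.pow_induction_on_left' with
  | algebraMap r => rw [AlgHom.commutes, DirectSum.algebraMap_apply]; rfl
  | add x y i hx hy ihx ihy => rw [map_add, ihx, ihy, ← map_add]; rfl
  | mem_mul m hm i x hx ih =>
    obtain ⟨v, rfl⟩ := hm
    rw [map_mul, ih, toDirectSum_gen, DirectSum.of_mul_of]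
    exact DirectSum.of_eq_of_gradedMonoid_eq (Sigma.subtype_ext (add_comm _ _) rfl)

/-- A quadratic algebra is graded by the length of words. -/
instance : GradedAlgebra (piece C) :=
  GradedAlgebra.ofAlgHom _ (toDirectSum C)
    (algHom_ext fun v => by simp [toDirectSum_gen])
    fun _ x => toDirectSum_of_mem x.2

variable (C) in
/-- The projection of `T(V)/(C)` onto its component of degree `j`. -/
def proj (j : ℕ) : Alg C →ₗ[F] Alg C := GradedAlgebra.proj (piece C) j

theorem proj_apply (j : ℕ) (a : Alg C) :
    proj C j a = (DirectSum.decompose (piece C) a j : Alg C) := rfl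

theorem proj_mem (j : ℕ) (a : Alg C) : proj C j a ∈ piece C j :=
  SetLike.coe_mem _

theorem proj_of_mem {j : ℕ} {a : Alg C} (ha : a ∈ piece C j) : proj C j a = a :=
  DirectSum.decompose_of_mem_same _ ha

theorem proj_of_mem_ne {i j : ℕ} {a : Alg C} (ha : a ∈ piece C i) (h : i ≠ j) : proj C j a = 0 :=
  DirectSum.decompose_of_mem_ne _ ha h

theorem proj_succ_gen_mul (j : ℕ) (v : V) (a : Alg C) :
    proj C (j + 1) (gen C v * a) = gen C v * proj C j a := by
  rw [add_comm]
  exact DirectSum.coe_decompose_mul_add_of_left_mem _ (gen_mem_piece v)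

theorem proj_succ_mul_gen (j : ℕ) (v : V) (a : Alg C) :
    proj C (j + 1) (a * gen C v) = proj C j a * gen C v :=
  DirectSum.coe_decompose_mul_add_of_right_mem _ (gen_mem_piece v)

theorem proj_zero_gen_mul (v : V) (a : Alg C) : proj C 0 (gen C v * a) = 0 :=
  DirectSum.coe_decompose_mul_of_left_mem_of_not_le _ (gen_mem_piece v) (by simp)

theorem proj_zero_apply (a : Alg C) : proj C 0 a = algebraMap F (Alg C) (aug C a) := by
  induction a using alg_induction with
  | one => rw [proj_of_mem (one_mem_piece_zero C)]; simp
  | gen_mul v x hx => rw [proj_zero_gen_mul]; simp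
  | add x y hx hy => simp only [map_add, hx, hy]
  | smul r x hx => rw [map_smul, hx, map_smul, smul_eq_mul, map_mul, Algebra.smul_def]

theorem aug_of_mem_piece_succ {j : ℕ} {a : Alg C} (ha : a ∈ piece C (j + 1)) : aug C a = 0 := by
  rw [piece, pow_succ'] at ha
  induction ha using Submodule.mul_induction_on' with
  | mem_mul_mem m hm n _ => obtain ⟨v, rfl⟩ := hm; simp
  | add x _ y _ hx hy => rw [map_add, hx, hy, add_zero]

theorem exists_proj_eq_zero (a : Alg C) : ∃ n, ∀ j, n ≤ j → proj C j a = 0 := by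
  classical
  refine ⟨(DirectSum.decompose (piece C) a).support.sup id + 1, fun j hj => ?_⟩
  have h : j ∉ (DirectSum.decompose (piece C) a).support := fun h =>
    absurd (Finset.le_sup (f := id) h) (by simp only [id]; omega)
  rw [proj_apply, DFinsupp.notMem_support_iff.mp h]
  rfl

theorem sum_proj {n : ℕ} {a : Alg C} (hn : ∀ j, n ≤ j → proj C j a = 0) :
    ∑ j ∈ Finset.range n, proj C j a = a := by
  classical
  conv_rhs => rw [← DirectSum.sum_support_decompose (piece C) a]
  refine (Finset.sum_subset (fun j hj => ?_) fun j _ hj => ?_).symm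
  · rw [Finset.mem_range]
    by_contra hlt
    refine DFinsupp.mem_support_iff.mp hj (Subtype.ext ?_)
    exact hn j (not_lt.mp hlt)
  · rw [proj_apply, DFinsupp.notMem_support_iff.mp hj]
    rfl

instance [FiniteDimensional F V] (p : ℕ) : FiniteDimensional F (piece C p) := by
  rw [FiniteDimensional, Module.finite_def, Submodule.fg_top]
  exact Submodule.FG.pow (by rw [LinearMap.range_eq_map]; exact Module.Finite.fg_top.map _) p

end

/-! ### Dimension shifting -/

section

open CategoryTheory Limits

universe v w

variable {𝒜 : Type w} [Category.{v} 𝒜] [Abelian 𝒜]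

/-- The augmentation `P₀ ⟶ Z` of a projective resolution of `Z`. -/
def resolutionAug {Z : 𝒜} (P : ProjectiveResolution Z) : P.complex.X 0 ⟶ Z :=
  P.π.f 0

@[simp]
theorem d_comp_resolutionAug {Z : 𝒜} (P : ProjectiveResolution Z) :
    P.complex.d 1 0 ≫ resolutionAug P = 0 :=
  P.complex_d_comp_π_f_zero

instance {Z : 𝒜} (P : ProjectiveResolution Z) : Epi (resolutionAug P) :=
  inferInstanceAs (Epi (P.π.f 0))

theorem exact_resolutionAug {Z : 𝒜} (P : ProjectiveResolution Z) :
    (ShortComplex.mk (P.complex.d 1 0) (resolutionAug P) (d_comp_resolutionAug P)).Exact :=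
  ShortComplex.exact_of_g_is_cokernel _ P.isColimitCokernelCofork

/-- Given a short exact sequence `0 → Z → K → M → 0` with `K` projective, a projective resolution
of `Z` is spliced with `K` to a projective resolution of `M`. -/
def spliceResolution {S : ShortComplex 𝒜} (hS : S.ShortExact) [Projective S.X₂]
    (P : ProjectiveResolution S.X₁) : ProjectiveResolution S.X₃ where
  complex := P.complex.augment (resolutionAug P ≫ S.f) (by
    rw [← Category.assoc, d_comp_resolutionAug, zero_comp])
  projective n := by
    cases n with
    | zero => exact inferInstanceAs (Projective S.X₂)
    | succ n => exact P.projective n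
  π := (ChainComplex.toSingle₀Equiv _ _).symm ⟨S.g, by
    change (resolutionAug P ≫ S.f) ≫ S.g = 0
    rw [Category.assoc, S.zero, comp_zero]⟩
  quasiIso := ⟨fun n => by
    have := hS.mono_f
    have := hS.epi_g
    have hd : P.complex.d 1 0 ≫ resolutionAug P ≫ S.f = 0 := by
      rw [← Category.assoc, d_comp_resolutionAug, zero_comp]
    cases n with
    | zero =>
      rw [ChainComplex.quasiIsoAt₀_iff, ShortComplex.quasiIso_iff_of_zeros']
      · have w : (resolutionAug P ≫ S.f) ≫ S.g = 0 := by rw [Category.assoc, S.zero, comp_zero]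
        let α : ShortComplex.mk (resolutionAug P ≫ S.f) S.g w ⟶ S :=
          { τ₁ := resolutionAug P
            τ₂ := 𝟙 _
            τ₃ := 𝟙 _ }
        have hα := (ShortComplex.exact_iff_of_epi_of_isIso_of_mono α).mpr hS.exact
        refine (ShortComplex.exact_and_epi_g_iff_of_iso ?_).2 ⟨hα, by dsimp; infer_instance⟩
        refine ShortComplex.isoMk (Iso.refl _) (Iso.refl _) (Iso.refl _) ?_ ?_
        · exact (Category.id_comp _).trans (Category.comp_id _).symm
        · refine (Category.id_comp _).trans (Eq.trans ?_ (Category.comp_id _).symm)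
          exact (ChainComplex.toSingle₀Equiv_symm_apply_f_zero
            (C := P.complex.augment (resolutionAug P ≫ S.f)
              (by rw [← Category.assoc, d_comp_resolutionAug, zero_comp])) S.g w).symm
      all_goals rfl
    | succ n =>
      rw [quasiIsoAt_iff_exactAt']
      · cases n with
        | zero =>
          rw [HomologicalComplex.exactAt_iff' _ 2 1 0 (by simp) (by simp)]
          let α : ShortComplex.mk (P.complex.d 1 0) (resolutionAug P) (d_comp_resolutionAug P) ⟶
              ShortComplex.mk (P.complex.d 1 0) (resolutionAug P ≫ S.f) hd :=
            { τ₁ := 𝟙 _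
              τ₂ := 𝟙 _
              τ₃ := S.f }
          exact (ShortComplex.exact_iff_of_epi_of_isIso_of_mono α).mp (exact_resolutionAug P)
        | succ n =>
          rw [HomologicalComplex.exactAt_iff' _ (n + 3) (n + 2) (n + 1) (by simp) (by simp)]
          exact P.exact_succ n
      · apply ChainComplex.exactAt_succ_single_obj⟩

variable {F : Type u} [Field F] [Linear F 𝒜] [EnoughProjectives 𝒜]

/-- Dimension shifting in degrees at least two. -/
theorem exists_ext_shift {S : ShortComplex 𝒜} (hS : S.ShortExact) [Projective S.X₂] (Y : 𝒜)
    (n : ℕ) :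
    Nonempty (((Ext F 𝒜 (n + 2)).obj (Opposite.op S.X₃)).obj Y ≅
      ((Ext F 𝒜 (n + 1)).obj (Opposite.op S.X₁)).obj Y) := by
  let P := ProjectiveResolution.of S.X₁
  let Q := spliceResolution hS P
  refine ⟨Q.isoExt (n + 2) Y ≪≫ ?_ ≪≫ (P.isoExt (n + 1) Y).symm⟩
  -- above degree zero, the spliced resolution is `P` with degrees raised by one
  refine ShortComplex.homologyMapIso ?_
  refine HomologicalComplex.isoSc' _ (n + 1) (n + 2) (n + 3) (by simp) (by simp) ≪≫ ?_ ≪≫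
    (HomologicalComplex.isoSc' _ n (n + 1) (n + 2) (by simp) (by simp)).symm
  exact ShortComplex.isoMk (Iso.refl _) (Iso.refl _) (Iso.refl _) (by rfl) (by rfl)

/-- Dimension shifting in degree one: if the morphisms `K ⟶ Y` vanish on `Z`, then
the connecting map `Hom(Z, Y) → Ext¹(M, Y)` is injective. -/
theorem exists_hom_to_ext_one {S : ShortComplex 𝒜} (hS : S.ShortExact) [Projective S.X₂] (Y : 𝒜)
    (hY : ∀ f : S.X₂ ⟶ Y, S.f ≫ f = 0) :
    ∃ α : (S.X₁ ⟶ Y) →ₗ[F] ((Ext F 𝒜 1).obj (Opposite.op S.X₃)).obj Y,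
      Function.Injective α := by
  let P := ProjectiveResolution.of S.X₁
  let Q := spliceResolution hS P
  let T := (Q.complex.linearYonedaObj F Y).sc' 0 1 2
  let e : T.moduleCatLeftHomologyData.H ≅ ((Ext F 𝒜 1).obj (Opposite.op S.X₃)).obj Y :=
    T.moduleCatHomologyIso.symm ≪≫
    ShortComplex.homologyMapIso
      (HomologicalComplex.isoSc' _ 0 1 2 (by simp) (by simp)).symm ≪≫
    (Q.isoExt (R := F) 1 Y).symm
  -- the connecting map sends `g` to the class of the cocycle `P₀ ⟶ Z ⟶ Y`
  let β : (S.X₁ ⟶ Y) →ₗ[F] T.X₂ := Linear.leftComp F Y (resolutionAug P)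
  have hβ : ∀ g, β g ∈ LinearMap.ker T.g.hom := fun g => by
    change P.complex.d 1 0 ≫ resolutionAug P ≫ g = 0
    rw [← Category.assoc, d_comp_resolutionAug, zero_comp]
  let γ : (S.X₁ ⟶ Y) →ₗ[F] T.moduleCatLeftHomologyData.H :=
    (LinearMap.range T.moduleCatToCycles).mkQ ∘ₗ β.codRestrict _ hβ
  refine ⟨e.hom.hom ∘ₗ γ, ?_⟩
  have he : Function.Injective e.hom.hom := e.toLinearEquiv.injective
  refine he.comp ((injective_iff_map_eq_zero γ).mpr fun g hg => ?_)
  obtain ⟨ψ, hψ⟩ := (Submodule.Quotient.mk_eq_zero _).mp hg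
  have h : (resolutionAug P ≫ S.f) ≫ (show S.X₂ ⟶ Y from ψ) = resolutionAug P ≫ g :=
    congrArg Subtype.val hψ
  rw [Category.assoc, hY, comp_zero] at h
  rwa [← cancel_epi (resolutionAug P), comp_zero, eq_comm]

/-- Iterated dimension shifting: along short exact sequences
`0 → M (q + 1) → K q → M q → 0`, `q ≤ p`, with `K q` projective and such that the morphisms
`K p ⟶ Y` vanish on `M (p + 1)`, the iterated connecting map
`Hom(M (p + 1), Y) → Ext^(p + 1)(M 0, Y)` is injective. -/
theorem exists_hom_to_ext (p : ℕ) (Y : 𝒜) (M K : ℕ → 𝒜) [∀ q, Projective (K q)]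
    (i : ∀ q, M (q + 1) ⟶ K q) (π : ∀ q, K q ⟶ M q) (w : ∀ q, i q ≫ π q = 0)
    (hS : ∀ q ≤ p, (ShortComplex.mk (i q) (π q) (w q)).ShortExact)
    (hY : ∀ f : K p ⟶ Y, i p ≫ f = 0) :
    ∃ α : (M (p + 1) ⟶ Y) →ₗ[F] ((Ext F 𝒜 (p + 1)).obj (Opposite.op (M 0))).obj Y,
      Function.Injective α := by
  induction p generalizing M K with
  | zero =>
    have : Projective (ShortComplex.mk (i 0) (π 0) (w 0)).X₂ := inferInstanceAs (Projective (K 0))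
    exact exists_hom_to_ext_one (hS 0 le_rfl) Y hY
  | succ p ih =>
    obtain ⟨α, hα⟩ := ih (fun q => M (q + 1)) (fun q => K (q + 1)) (fun q => i (q + 1))
      (fun q => π (q + 1)) (fun q => w (q + 1)) (fun q hq => hS (q + 1) (by omega)) hY
    have : Projective (ShortComplex.mk (i 0) (π 0) (w 0)).X₂ := inferInstanceAs (Projective (K 0))
    obtain ⟨e⟩ := exists_ext_shift (F := F) (hS 0 (by omega)) Y p
    exact ⟨e.inv.hom ∘ₗ α, e.symm.toLinearEquiv.injective.comp hα⟩

end

/-! ### The Koszul complex in terms of linear maps -/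

section

variable {F : Type u} [Field F] {V : Type u} [AddCommGroup V] [Module F V]

variable {C : Submodule F (V ⊗[F] V)}

@[simp]
theorem coe_genMul (v : V) (p : ℕ) (x : piece C p) :
    (genMul C v p x : Alg C) = gen C v * x := rfl

/-- Linear maps on the component of degree `p + 1` agree if they do so on the products of a
generator and an element of degree `p`. -/
theorem linearMap_piece_succ_ext {N : Type*} [AddCommGroup N] [Module F N] {p : ℕ}
    {f g : piece C (p + 1) →ₗ[F] N} (h : ∀ v x, f (genMul C v p x) = g (genMul C v p x)) :
    f = g := by
  have hmul : piece C (p + 1) = LinearMap.range (gen C) * piece C p := pow_succ' _ _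
  ext ⟨y, hy⟩
  have hy' := hy
  rw [hmul] at hy'
  induction hy' using Submodule.mul_induction_on' with
  | mem_mul_mem m hm n hn => obtain ⟨v, rfl⟩ := hm; exact h v ⟨n, hn⟩
  | add x hx z hz ihx ihz =>
    rw [← hmul] at hx hz
    have e : (⟨x + z, hy⟩ : piece C (p + 1)) = ⟨x, hx⟩ + ⟨z, hz⟩ := rfl
    rw [e, map_add, map_add, ihx hx, ihz hz]

theorem exists_eq_smul_one (y : piece C 0) :
    ∃ r : F, y = r • (⟨1, one_mem_piece_zero C⟩ : piece C 0) := by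
  obtain ⟨y, hy⟩ := y
  have hy' := hy
  rw [piece, pow_zero, Submodule.mem_one] at hy'
  obtain ⟨r, rfl⟩ := hy'
  exact ⟨r, Subtype.ext (Algebra.algebraMap_eq_smul_one r)⟩

/-- A linear form that vanishes on the products `v • m` with a generator `v` is a homomorphism into
the trivial module. -/
def toTrivial {M : Type u} [AddCommGroup M] [Module F M] [Module (Alg C) M]
    [IsScalarTower F (Alg C) M] (ψ : M →ₗ[F] F) (hψ : ∀ v m, ψ (gen C v • m) = 0) :
    M →ₗ[Alg C] trivialModule C where
  toFun m := (show F from ψ m)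
  map_add' := ψ.map_add
  map_smul' u m := by
    change ψ (u • m) = aug C u * ψ m
    induction u using alg_induction generalizing m with
    | one => simp
    | gen_mul v x _ => rw [mul_smul, hψ]; simp
    | add x y hx hy => rw [add_smul, map_add, hx, hy, map_add, add_mul]
    | smul r x hx => rw [smul_assoc, map_smul, hx, map_smul, smul_eq_mul, smul_eq_mul, mul_assoc]

variable (C)

/-- The extension of a linear map on the component of degree `p` by zero to the other
components. -/
def extend {N : Type*} [AddCommGroup N] [Module F N] {p : ℕ}
    (h : piece C p →ₗ[F] N) : Alg C →ₗ[F] N :=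
  h ∘ₗ (proj C p).codRestrict _ (proj_mem p)

theorem extend_coe {N : Type*} [AddCommGroup N] [Module F N] {p : ℕ}
    (h : piece C p →ₗ[F] N) (y : piece C p) : extend C h y = h y :=
  congrArg h (Subtype.ext (proj_of_mem y.2))

theorem extend_gen_mul_zero {N : Type*} [AddCommGroup N] [Module F N]
    (t : piece C 0 →ₗ[F] N) (v : V) (a : Alg C) :
    extend C t (gen C v * a) = 0 := by
  have h : (proj C 0).codRestrict _ (proj_mem 0) (gen C v * a) = 0 :=
    Subtype.ext (proj_zero_gen_mul v a)
  rw [extend, LinearMap.comp_apply, h, map_zero]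

theorem extend_gen_mul_succ {N : Type*} [AddCommGroup N] [Module F N] {p : ℕ}
    (t : piece C (p + 1) →ₗ[F] N) (v : V) (a : Alg C) :
    extend C t (gen C v * a) = t (genMul C v p ⟨proj C p a, proj_mem p a⟩) :=
  congrArg t (Subtype.ext (proj_succ_gen_mul p v a))

/-- The term `U ⊗ (U^!_p)*` of the Koszul complex, seen as the space of linear maps
`U^!_p → U`. -/
abbrev KHom (p : ℕ) : Type u := piece (perp C) p →ₗ[F] Alg C

/-- The augmentation of the Koszul complex in terms of linear maps `U^!_0 → U`. -/
def kHomAug : KHom C 0 →ₗ[Alg C] trivialModule C :=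
  toTrivial ((aug C).toLinearMap ∘ₗ LinearMap.applyₗ ⟨1, one_mem_piece_zero (perp C)⟩)
    fun v h => by simp

variable [FiniteDimensional F V]

/-- The identification of `U ⊗ (U^!_p)*` with the space of linear maps `U^!_p → U`. -/
def toKHom (p : ℕ) : koszulX C p ≃ₗ[Alg C] KHom C p :=
  let e := TensorProduct.comm F (Alg C) (Module.Dual F (piece (perp C) p)) ≪≫ₗ
    dualTensorHomEquiv F (piece (perp C) p) (Alg C)
  { e with
    map_smul' := fun u x => by
      change e (u • x) = u • e x
      induction x using TensorProduct.induction_on with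
      | zero => simp
      | tmul w f =>
        ext y
        simp [e, TensorProduct.smul_tmul']
      | add x y hx hy => rw [smul_add, map_add, hx, hy, map_add, smul_add] }

@[simp]
theorem toKHom_tmul (p : ℕ) (u : Alg C) (f : Module.Dual F (piece (perp C) p))
    (y : piece (perp C) p) : toKHom C p (u ⊗ₜ f) y = f y • u := by
  change (TensorProduct.comm F (Alg C) (Module.Dual F (piece (perp C) p)) ≪≫ₗ
    dualTensorHomEquiv F (piece (perp C) p) (Alg C)) (u ⊗ₜ f) y = _
  simp

/-- The differential of the Koszul complex in terms of linear maps `U^!_p → U`. -/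
def kHomD (p : ℕ) : KHom C (p + 1) →ₗ[Alg C] KHom C p where
  toFun h := ∑ i, LinearMap.mulRight F (gen C (Module.finBasis F V i)) ∘ₗ h ∘ₗ
    genMul (perp C) ((Module.finBasis F V).coord i) p
  map_add' h h' := by
    ext y
    simp [add_mul, Finset.sum_add_distrib]
  map_smul' u h := by
    ext y
    simp [mul_assoc, Finset.mul_sum]

theorem kHomD_apply (p : ℕ) (h : KHom C (p + 1)) (y : piece (perp C) p) :
    kHomD C p h y = ∑ i, h (genMul (perp C) ((Module.finBasis F V).coord i) p y) *
      gen C (Module.finBasis F V i) := by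
  simp [kHomD]

theorem toKHom_koszulD (p : ℕ) (x : koszulX C (p + 1)) :
    toKHom C p (koszulD C p x) = kHomD C p (toKHom C (p + 1) x) := by
  induction x using TensorProduct.induction_on with
  | zero => simp
  | tmul u f =>
    ext y
    simp [koszulD, kHomD_apply, LinearMap.sum_apply]
  | add x y hx hy => simp only [map_add, hx, hy]

theorem kHomAug_toKHom (x : koszulX C 0) : kHomAug C (toKHom C 0 x) = koszulAug C x := by
  change aug C (toKHom C 0 x ⟨1, one_mem_piece_zero (perp C)⟩) = koszulAug C x
  induction x using TensorProduct.induction_on with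
  | zero => simp
  | tmul u f => simp [koszulAug, mul_comm]
  | add x y hx hy => simp only [map_add, LinearMap.add_apply, hx, hy]

/-- The cycles of the augmented Koszul complex in degree `p`. -/
def cycles : (p : ℕ) → Submodule (Alg C) (KHom C p)
  | 0 => LinearMap.ker (kHomAug C)
  | p + 1 => LinearMap.ker (kHomD C p)

/-- The square of the canonical element `∑ i, eⁱ ⊗ eᵢ` of `U^! ⊗ U` vanishes. -/
theorem canonical_sq :
    ∑ i, ∑ j, (gen (perp C) ((Module.finBasis F V).coord i) *
        gen (perp C) ((Module.finBasis F V).coord j)) ⊗ₜ[F]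
      (gen C (Module.finBasis F V i) * gen C (Module.finBasis F V j)) = 0 := by
  set e := Module.finBasis F V
  let b := Module.Free.chooseBasis F (Alg (perp C))
  refine (TensorProduct.equivFinsuppOfBasisLeft b).injective ?_
  ext k
  simp only [map_sum, map_zero, Finsupp.finsetSum_apply, Finsupp.zero_apply,
    TensorProduct.equivFinsuppOfBasisLeft_apply_tmul_apply]
  refine (Module.forall_dual_apply_eq_zero_iff F _).mp fun ρ => ?_
  let r : Module.Dual F V ⊗[F] Module.Dual F V :=
    ∑ i, ∑ j, ρ (gen C (e i) * gen C (e j)) • (e.coord i ⊗ₜ[F] e.coord j)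
  -- `ρ` vanishes on the relations of `U`, so its coordinates form a relation of `U^!`
  have hr : r ∈ perp C := by
    have key : ∀ c, TensorProduct.dualDistrib F V V r c = ρ (mulSq (gen C) c) := fun c => by
      induction c with
      | zero => simp
      | tmul v w =>
        have hg : ∀ x, gen C x = ∑ i, e.coord i x • gen C (e i) := fun x => by
          conv_lhs => rw [← e.sum_repr x, map_sum]
          simp
        rw [mulSq_tmul, hg v, hg w, Finset.sum_mul_sum]
        simp [r, LinearMap.sum_apply, mul_comm, mul_assoc, mul_left_comm]
      | add x y hx hy => rw [map_add, hx, hy, map_add, map_add]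
    rw [perp, Submodule.mem_comap, Submodule.mem_dualAnnihilator]
    intro c hc
    rw [key, mulSq_gen_eq_zero hc, map_zero]
  have := congrArg (b.coord k) (mulSq_gen_eq_zero hr)
  simpa [r, mul_comm] using this

theorem kHomD_kHomD (p : ℕ) (h : KHom C (p + 2)) : kHomD C p (kHomD C (p + 1) h) = 0 := by
  ext y
  have := congrArg (LinearMap.mul' F (Alg C) ∘ₗ TensorProduct.map
    (extend (perp C) h ∘ₗ LinearMap.mulRight F (y : Alg (perp C))) LinearMap.id) (canonical_sq C)
  rw [map_zero] at this
  rw [LinearMap.zero_apply, ← this, kHomD_apply]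
  simp only [kHomD_apply, map_sum, LinearMap.comp_apply, TensorProduct.map_tmul,
    LinearMap.mulRight_apply, LinearMap.mul'_apply, LinearMap.id_apply, Finset.sum_mul]
  rw [Finset.sum_comm]
  refine Finset.sum_congr rfl fun i _ => Finset.sum_congr rfl fun j _ => ?_
  rw [← mul_assoc, ← extend_coe]
  simp [mul_assoc]

theorem kHomD_mem_cycles (p : ℕ) (h : KHom C (p + 1)) : kHomD C p h ∈ cycles C p := by
  cases p with
  | zero =>
    change aug C (kHomD C 0 h ⟨1, one_mem_piece_zero (perp C)⟩) = 0
    rw [kHomD_apply]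
    simp
  | succ p => exact kHomD_kHomD C p h

end

/-! ### Cycles of the Koszul complex and the internal grading -/

section

variable {F : Type u} [Field F] {V : Type u} [AddCommGroup V] [Module F V]

variable (C : Submodule F (V ⊗[F] V))

/-- A linear form on `U^!_p`, seen as a linear map `U^!_p → U`. -/
def kHomConst (p : ℕ) : Module.Dual F (piece (perp C) p) →ₗ[F] KHom C p where
  toFun f := (Algebra.linearMap F (Alg C)) ∘ₗ f
  map_add' f g := by ext; simp
  map_smul' r f := by ext; simp [Algebra.smul_def]

@[simp]
theorem kHomConst_apply (p : ℕ) (f : Module.Dual F (piece (perp C) p)) (y : piece (perp C) p) :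
    kHomConst C p f y = algebraMap F (Alg C) (f y) := rfl

/-- The projection of `U ⊗ (U^!_p)*` onto `U_j ⊗ (U^!_p)*`. -/
def kHomProj (p j : ℕ) : KHom C p →ₗ[F] KHom C p where
  toFun h := proj C j ∘ₗ h
  map_add' f g := by ext; simp
  map_smul' r f := by ext; simp

@[simp]
theorem kHomProj_apply (p j : ℕ) (h : KHom C p) (y : piece (perp C) p) :
    kHomProj C p j h y = proj C j (h y) := rfl

theorem aug_proj_zero (a : Alg C) : aug C (proj C 0 a) = aug C a := by
  rw [proj_zero_apply, AlgHom.commutes]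
  rfl

theorem aug_proj_succ (j : ℕ) (a : Alg C) : aug C (proj C (j + 1) a) = 0 :=
  aug_of_mem_piece_succ (proj_mem _ a)

theorem proj_proj_self (j : ℕ) (a : Alg C) : proj C j (proj C j a) = proj C j a :=
  proj_of_mem (proj_mem j a)

theorem proj_proj_ne {i j : ℕ} (h : i ≠ j) (a : Alg C) : proj C j (proj C i a) = 0 :=
  proj_of_mem_ne (proj_mem i a) h

theorem kHomProj_succ_gen_smul (p j : ℕ) (v : V) (h : KHom C p) :
    kHomProj C p (j + 1) (gen C v • h) = gen C v • kHomProj C p j h := by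
  ext y
  simp [proj_succ_gen_mul]

variable [FiniteDimensional F V]

theorem kHomD_kHomProj (p j : ℕ) (h : KHom C (p + 1)) :
    kHomD C p (kHomProj C (p + 1) j h) = kHomProj C p (j + 1) (kHomD C p h) := by
  ext y
  simp only [kHomD_apply, kHomProj_apply, map_sum, proj_succ_mul_gen]

theorem kHomProj_mem_cycles {p : ℕ} (j : ℕ) {h : KHom C p} (hh : h ∈ cycles C p) :
    kHomProj C p j h ∈ cycles C p := by
  cases p with
  | zero =>
    have hh' : aug C (h ⟨1, one_mem_piece_zero (perp C)⟩) = 0 := hh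
    change aug C (proj C j (h ⟨1, one_mem_piece_zero (perp C)⟩)) = 0
    cases j with
    | zero => rw [aug_proj_zero, hh']
    | succ j => rw [aug_proj_succ]
  | succ p =>
    change kHomD C p _ = 0
    rw [kHomD_kHomProj, LinearMap.mem_ker.mp hh, map_zero]

/-- An element of `U ⊗ (U^!_p)*` is a sum of multiples of elements of `(U^!_p)*`. -/
theorem exists_eq_sum_kHomConst (p : ℕ) (h : KHom C p) :
    ∃ (n : ℕ) (y : Fin n → piece (perp C) p) (f : Fin n → Module.Dual F (piece (perp C) p)),
      h = ∑ k, h (y k) • kHomConst C p (f k) := by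
  let b := Module.finBasis F (piece (perp C) p)
  refine ⟨_, b, b.coord, b.ext fun k => ?_⟩
  simp [LinearMap.sum_apply, Finsupp.single_apply]

theorem dual_sum_coord (w : Module.Dual F V) :
    ∑ i, w (Module.finBasis F V i) • (Module.finBasis F V).coord i = w :=
  (Module.finBasis F V).sum_dual_apply_smul_coord w

theorem kHomD_kHomConst_apply (p : ℕ) (f : Module.Dual F (piece (perp C) (p + 1)))
    (y : piece (perp C) p) :
    kHomD C p (kHomConst C (p + 1) f) y =
      gen C (∑ i, f (genMul (perp C) ((Module.finBasis F V).coord i) p y) •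
        Module.finBasis F V i) := by
  simp [kHomD_apply, Algebra.smul_def]

theorem genMul_eq_sum {p : ℕ} (w : Module.Dual F V) (y : piece (perp C) p) :
    genMul (perp C) w p y =
      ∑ i, w (Module.finBasis F V i) • genMul (perp C) ((Module.finBasis F V).coord i) p y := by
  ext
  conv_lhs => rw [coe_genMul, ← dual_sum_coord w]
  simp [Finset.sum_mul, -Module.Basis.sum_dual_apply_smul_coord]

/-- The Koszul differential is injective in the lowest internal degree. -/
theorem kHomD_kHomConst_injective (p : ℕ) :
    Function.Injective fun f => kHomD C p (kHomConst C (p + 1) f) := by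
  have : Function.Injective (((kHomD C p).restrictScalars F) ∘ₗ kHomConst C (p + 1)) := by
    refine (injective_iff_map_eq_zero _).mpr fun f hf => linearMap_piece_succ_ext fun w y => ?_
    have h := LinearMap.congr_fun hf y
    change kHomD C p (kHomConst C (p + 1) f) y = 0 at h
    rw [kHomD_kHomConst_apply, ← map_zero (gen C)] at h
    have h0 := Fintype.linearIndependent_iff.mp (Module.finBasis F V).linearIndependent _
      (gen_injective h)
    rw [genMul_eq_sum, map_sum]
    exact Finset.sum_eq_zero fun i _ => by rw [map_smul, h0, smul_zero]
  exact this

/-- The Koszul complex is minimal: its cycles have no component of internal degree zero. -/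
theorem aug_of_mem_cycles {p : ℕ} {z : KHom C p} (hz : z ∈ cycles C p) (y : piece (perp C) p) :
    aug C (z y) = 0 := by
  cases p with
  | zero =>
    obtain ⟨r, rfl⟩ := exists_eq_smul_one y
    have hz' : aug C (z ⟨1, one_mem_piece_zero (perp C)⟩) = 0 := hz
    rw [map_smul, map_smul, hz', smul_zero]
  | succ p =>
    suffices h : (aug C).toLinearMap ∘ₗ z = 0 from LinearMap.congr_fun h y
    refine kHomD_kHomConst_injective C p ?_
    have h0 : kHomConst C (p + 1) ((aug C).toLinearMap ∘ₗ z) = kHomProj C (p + 1) 0 z := by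
      ext y
      rw [kHomConst_apply, kHomProj_apply, proj_zero_apply]
      rfl
    have h1 : kHomD C p z = 0 := hz
    dsimp only
    rw [h0, kHomD_kHomProj, h1, map_zero, map_zero, map_zero]

theorem kHomProj_zero_of_mem_cycles {p : ℕ} {z : KHom C p} (hz : z ∈ cycles C p) :
    kHomProj C p 0 z = 0 := by
  ext y
  rw [kHomProj_apply, proj_zero_apply, aug_of_mem_cycles C hz, map_zero]
  rfl

/-- Let `t : U^!_(p + 1) → V` be such that `∑ i, t (eⁱ y) eᵢ` vanishes in `U` for all `y`. Then
the pairing `(w, y) ↦ w (t y)` on `V* ⊗ U^!_(p + 1)` kills the relations of `U^!`. -/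
theorem lift_extend_eq_zero {p : ℕ} (t : piece (perp C) (p + 1) →ₗ[F] V)
    (ht : ∀ y, ∑ i, gen C (t (genMul (perp C) ((Module.finBasis F V).coord i) p y)) *
      gen C (Module.finBasis F V i) = 0)
    {r : Module.Dual F V ⊗[F] Module.Dual F V} (hr : r ∈ perp C) (a : Alg (perp C)) :
    TensorProduct.lift
      ((LinearMap.lcomp F F ((LinearMap.mul F (Alg (perp C))).flip a ∘ₗ gen (perp C))) ∘ₗ
        LinearMap.lcomp F F (extend (perp C) t)) r = 0 := by
  let e := Module.finBasis F V
  let y : piece (perp C) p := ⟨proj (perp C) p a, proj_mem p a⟩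
  let c : V ⊗[F] V := ∑ i, t (genMul (perp C) (e.coord i) p y) ⊗ₜ[F] e i
  have hw : ∀ w, extend (perp C) t (gen (perp C) w * a) =
      ∑ i, w (e i) • t (genMul (perp C) (e.coord i) p y) := fun w => by
    rw [extend_gen_mul_succ, genMul_eq_sum, map_sum]
    simp only [map_smul, e, y]
  have hc : mulSq (gen C) c = 0 := by
    rw [← ht y, map_sum]
    exact Finset.sum_congr rfl fun i _ => mulSq_tmul _ _ _
  have key : ∀ s, TensorProduct.lift ((LinearMap.lcomp F F
      ((LinearMap.mul F (Alg (perp C))).flip a ∘ₗ gen (perp C))) ∘ₗ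
        LinearMap.lcomp F F (extend (perp C) t)) s =
          TensorProduct.dualDistrib F V V s c := fun s => by
    induction s with
    | zero => simp
    | tmul w w' =>
      have h1 : TensorProduct.lift ((LinearMap.lcomp F F
          ((LinearMap.mul F (Alg (perp C))).flip a ∘ₗ gen (perp C))) ∘ₗ
            LinearMap.lcomp F F (extend (perp C) t)) (w ⊗ₜ w') =
              w (extend (perp C) t (gen (perp C) w' * a)) := rfl
      rw [h1, hw]
      simp [c, mul_comm]
    | add x y hx hy => rw [map_add, hx, hy, map_add, LinearMap.add_apply]
  obtain ⟨ρ, hρ⟩ := exists_functional_mulSq (C := C) (TensorProduct.dualDistrib F V V r)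
    ((Submodule.mem_dualAnnihilator _).mp hr)
  rw [key, ← hρ, hc, map_zero]

/-- The cycles of internal degree one are boundaries: this is where the relations `perp C` of
`U^!` are dual to the relations `C` of `U`. -/
theorem exists_kHomD_kHomConst_eq {p : ℕ} {z : KHom C p} (hz : z ∈ cycles C p) :
    ∃ f, kHomD C p (kHomConst C (p + 1) f) = kHomProj C p 1 z := by
  obtain ⟨π, hπ⟩ := exists_degreeOne C
  -- the degree one part of `z`, as a linear map with values in `V`
  let t : piece (perp C) p →ₗ[F] V := π ∘ₗ proj C 1 ∘ₗ z
  have hgen : ∀ y, gen C (t y) = proj C 1 (z y) := fun y => by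
    have h := proj_mem 1 (z y)
    rw [piece, pow_one] at h
    obtain ⟨v, hv⟩ := h
    simp only [t, LinearMap.comp_apply]
    rw [← hv]
    simpa using congrArg (gen C) (hπ v 1)
  obtain ⟨f, hf⟩ := exists_linearMap_gen_mul (C := perp C)
    (LinearMap.lcomp F F (extend (perp C) t)) (by
      intro r hr a
      clear_value t
      cases p with
      | zero =>
        convert LinearMap.zero_apply (σ₁₂ := RingHom.id F) r
        ext w w'
        change w (extend (perp C) t (gen (perp C) w' * a)) = 0
        rw [extend_gen_mul_zero, map_zero]
      | succ q =>
        refine lift_extend_eq_zero C t (fun y => ?_) hr a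
        have hz0 : kHomD C q z = 0 := hz
        have h := congrArg (proj C 2) (LinearMap.congr_fun hz0 y)
        rw [LinearMap.zero_apply, map_zero, kHomD_apply, map_sum] at h
        rw [← h]
        refine Finset.sum_congr rfl fun i _ => ?_
        rw [hgen, proj_succ_mul_gen])
  refine ⟨f ∘ₗ (piece (perp C) (p + 1)).subtype, LinearMap.ext fun y => ?_⟩
  rw [kHomD_kHomConst_apply, kHomProj_apply, ← hgen]
  congr 1
  conv_rhs => rw [← (Module.finBasis F V).sum_repr (t y)]
  refine Finset.sum_congr rfl fun i _ => ?_
  congr 1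
  change f (gen (perp C) ((Module.finBasis F V).coord i) * y) = _
  rw [hf]
  change (Module.finBasis F V).coord i (extend (perp C) t y) = _
  rw [extend_coe]
  rfl

end

/-! ### The induction step -/

section

variable {F : Type u} [Field F] {V : Type u} [AddCommGroup V] [Module F V]
  (C : Submodule F (V ⊗[F] V))

open CategoryTheory

/-- `toTrivial` as a morphism in the category of modules. -/
def toTrivialHom {M : Type u} [AddCommGroup M] [Module F M] [Module (Alg C) M]
    [IsScalarTower F (Alg C) M] (ψ : M →ₗ[F] F) (hψ : ∀ v m, ψ (gen C v • m) = 0) :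
    ModuleCat.of (Alg C) M ⟶ trivialModule C :=
  @ModuleCat.ofHom (Alg C) _ M (trivialModule C) _ _ _ (trivialModule C).isModule (toTrivial ψ hψ)

theorem hom_trivial_smul_apply {M : ModuleCat.{u} (Alg C)} (r : F) (f : M ⟶ trivialModule C)
    (m : M) : (show F from (r • f).hom m) = r * (show F from f.hom m) := by
  change aug C (algebraMap F (Alg C) r) * _ = _
  rw [AlgHom.commutes]
  rfl

theorem kHomAug_surjective : Function.Surjective (kHomAug C) := fun r => by
  refine ⟨kHomConst C 0 (LinearMap.toSpanSingleton F F (show F from r) ∘ₗ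
    (aug (perp C)).toLinearMap ∘ₗ (piece (perp C) 0).subtype), ?_⟩
  change aug C (kHomConst C 0 _ ⟨1, one_mem_piece_zero (perp C)⟩) = (show F from r)
  rw [kHomConst_apply, AlgHom.commutes]
  change (aug (perp C) 1 • (show F from r) : F) = (show F from r)
  rw [map_one, one_smul]

variable [FiniteDimensional F V]

/-- A homomorphism from a term of the Koszul complex to the trivial module kills the cycles. -/
theorem hom_trivial_of_mem_cycles {p : ℕ} (φ : KHom C p →ₗ[Alg C] trivialModule C) {z : KHom C p}
    (hz : z ∈ cycles C p) : φ z = 0 := by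
  obtain ⟨n, y, f, h⟩ := exists_eq_sum_kHomConst C p z
  rw [h, map_sum]
  refine Finset.sum_eq_zero fun k _ => ?_
  rw [map_smul]
  change aug C (z (y k)) * (show F from φ (kHomConst C p (f k))) = 0
  rw [aug_of_mem_cycles C hz, zero_mul]

/-- A submodule contains an element as soon as it contains all its homogeneous components. -/
theorem mem_of_kHomProj_mem {p : ℕ} {N : Submodule (Alg C) (KHom C p)} {z : KHom C p}
    (h : ∀ j, kHomProj C p j z ∈ N) : z ∈ N := by
  let b := Module.finBasis F (piece (perp C) p)
  choose n hn using fun a : Alg C => exists_proj_eq_zero a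
  suffices hz : z = ∑ j ∈ Finset.range (Finset.univ.sup fun k => n (z (b k))),
      kHomProj C p j z by
    rw [hz]
    exact Submodule.sum_mem _ fun j _ => h j
  refine b.ext fun k => ?_
  rw [LinearMap.sum_apply]
  simp only [kHomProj_apply]
  exact (sum_proj fun j hj => hn _ _
    ((Finset.le_sup (f := fun k => n (z (b k))) (Finset.mem_univ k)).trans hj)).symm

/-- The Koszul complex is exact in degree `p` as soon as the homomorphisms from the cycles of
degree `p` to the trivial module form a vector space of dimension at most that of
`U^!_(p + 1)`. -/
theorem exists_kHomD_eq_of_injective {p : ℕ} {E : Type u} [AddCommGroup E] [Module F E]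
    (α : (ModuleCat.of (Alg C) (cycles C p) ⟶ trivialModule C) →ₗ[F] E)
    (hα : Function.Injective α) (e : E ≃ₗ[F] piece (perp C) (p + 1)) {z : KHom C p}
    (hz : z ∈ cycles C p) : ∃ h, kHomD C p h = z := by
  let δ : Module.Dual F (piece (perp C) (p + 1)) →ₗ[F] KHom C p :=
    (kHomD C p).restrictScalars F ∘ₗ kHomConst C (p + 1)
  have hδ : ∀ f, δ f ∈ cycles C p := fun f => kHomD_mem_cycles C p _
  obtain ⟨δ', hδ'⟩ := δ.exists_leftInverse_of_injective
    (LinearMap.ker_eq_bot.mpr (kHomD_kHomConst_injective C p))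
  have hδ'' : ∀ f, δ' (δ f) = f := fun f => LinearMap.congr_fun hδ' f
  have hδ1 : ∀ f, kHomProj C p 1 (δ f) = δ f := fun f => by
    ext y
    change proj C 1 (kHomD C p (kHomConst C (p + 1) f) y) = kHomD C p (kHomConst C (p + 1) f) y
    rw [kHomD_kHomConst_apply]
    exact proj_of_mem (gen_mem_piece _)
  -- `δ` identifies `(U^!_(p + 1))*` with the cycles of internal degree one, so an element of
  -- `U^!_(p + 1)` is a functional on these, which `β` extends by zero to the other degrees
  let θ : cycles C p →ₗ[F] Module.Dual F (piece (perp C) (p + 1)) :=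
    δ' ∘ₗ kHomProj C p 1 ∘ₗ (cycles C p).subtype.restrictScalars F
  have hθ : ∀ v (z : cycles C p), θ (gen C v • z) = 0 := fun v z => by
    change δ' (kHomProj C p (0 + 1) (gen C v • (z : KHom C p))) = 0
    rw [kHomProj_succ_gen_smul, kHomProj_zero_of_mem_cycles C z.2, smul_zero, map_zero]
  have hθa : ∀ (a : piece (perp C) (p + 1)) v (z : cycles C p),
      (LinearMap.applyₗ a ∘ₗ θ) (gen C v • z) = 0 := fun a v z => by
    rw [LinearMap.comp_apply, hθ, map_zero]
  let β₀ (a : piece (perp C) (p + 1)) :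
      ModuleCat.of (Alg C) (cycles C p) ⟶ trivialModule C :=
    toTrivialHom C _ (hθa a)
  let β : piece (perp C) (p + 1) →ₗ[F]
      (ModuleCat.of (Alg C) (cycles C p) ⟶ trivialModule C) :=
    { toFun := β₀
      map_add' := fun a b => ModuleCat.hom_ext (LinearMap.ext fun z => (θ z).map_add a b)
      map_smul' := fun r a => ModuleCat.hom_ext (LinearMap.ext fun z =>
        ((θ z).map_smul r a).trans (hom_trivial_smul_apply C r (β₀ a) z).symm) }
  have hβ : ∀ a f, (show F from (β a).hom ⟨δ f, hδ f⟩) = f a := fun a f => by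
    change δ' (kHomProj C p 1 (δ f)) a = f a
    rw [hδ1, hδ'']
  have hβinj : Function.Injective β := (injective_iff_map_eq_zero β).mpr fun a ha => by
    refine (Module.forall_dual_apply_eq_zero_iff F a).mp fun f => ?_
    rw [← hβ, ha]
    rfl
  -- a dimension count: there are no other homomorphisms
  have hβsurj : Function.Surjective β := by
    let κ := e.toLinearMap ∘ₗ α ∘ₗ β
    have hκ : Function.Injective κ := e.injective.comp (hα.comp hβinj)
    intro ψ
    obtain ⟨a, ha⟩ := LinearMap.surjective_of_injective hκ (e (α ψ))
    exact ⟨a, hα (e.injective ha)⟩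
  by_contra hne
  let N := LinearMap.range (kHomD C p)
  have hex : ∃ j, ∃ z ∈ cycles C p, kHomProj C p j z ∉ N := by
    by_contra! hall
    exact hne (mem_of_kHomProj_mem C (N := N) fun j => hall j z hz)
  classical
  obtain ⟨j, ⟨w, hw, hwN⟩, hmin⟩ : ∃ j, (∃ z ∈ cycles C p, kHomProj C p j z ∉ N) ∧
      ∀ i < j, ∀ z ∈ cycles C p, kHomProj C p i z ∈ N :=
    ⟨Nat.find hex, Nat.find_spec hex, fun i hi z hz => by
      by_contra h
      exact Nat.find_min hex hi ⟨z, hz, h⟩⟩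
  have hwN' : kHomProj C p j w ∉ N.restrictScalars F := hwN
  obtain ⟨φ, hφw, hφN⟩ := Submodule.exists_le_ker_of_notMem hwN'
  have hφ : ∀ x ∈ N, φ x = 0 := fun x hx => hφN hx
  -- the degree `j` part of the cycles, modulo boundaries, provides a further homomorphism
  obtain ⟨k, rfl⟩ : ∃ k, j = k + 2 := by
    match j with
    | 0 => exact absurd (by rw [kHomProj_zero_of_mem_cycles C hw]; exact N.zero_mem) hwN
    | 1 =>
      obtain ⟨f, hf⟩ := exists_kHomD_kHomConst_eq C hw
      exact absurd ⟨_, hf⟩ hwN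
    | k + 2 => exact ⟨k, rfl⟩
  have hφv : ∀ v (z : cycles C p), (φ ∘ₗ kHomProj C p (k + 2) ∘ₗ
      (cycles C p).subtype.restrictScalars F) (gen C v • z) = 0 := fun v z => by
    change φ (kHomProj C p (k + 1 + 1) (gen C v • (z : KHom C p))) = 0
    rw [kHomProj_succ_gen_smul]
    exact hφ _ (N.smul_mem _ (hmin (k + 1) (by omega) z z.2))
  let ψ : ModuleCat.of (Alg C) (cycles C p) ⟶ trivialModule C :=
    toTrivialHom C _ hφv
  obtain ⟨a, ha⟩ := hβsurj ψ
  -- it vanishes in internal degree one, hence comes from `a = 0`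
  have ha0 : a = 0 := by
    refine (Module.forall_dual_apply_eq_zero_iff F a).mp fun f => ?_
    rw [← hβ, ha]
    change φ (kHomProj C p (k + 2) (δ f)) = 0
    have h0 : kHomProj C p (k + 2) (δ f) = 0 := by
      rw [← hδ1]
      ext y
      exact proj_proj_ne C (by omega) _
    rw [h0, map_zero]
  have hψ : ψ.hom ⟨_, kHomProj_mem_cycles C (k + 2) hw⟩ = 0 := by
    rw [← ha, ha0, map_zero]
    rfl
  refine hφw ?_
  have hidem : kHomProj C p (k + 2) (kHomProj C p (k + 2) w) = kHomProj C p (k + 2) w := by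
    ext y
    exact proj_proj_self C _ _
  rw [← hidem]
  exact hψ

/-- The trivial module followed by the cycles of the augmented Koszul complex; where that complex is
exact, these are the syzygies of the trivial module. -/
def syzygy : ℕ → ModuleCat.{u} (Alg C)
  | 0 => trivialModule C
  | q + 1 => ModuleCat.of (Alg C) (cycles C q)

/-- The map from a term of the Koszul complex onto the corresponding syzygy. -/
def toSyzygy : (q : ℕ) → (ModuleCat.of (Alg C) (KHom C q) ⟶ syzygy C q)
  | 0 => ModuleCat.ofHom (Y := trivialModule C) (kHomAug C)
  | q + 1 => ModuleCat.ofHom ((kHomD C q).codRestrict (cycles C q) (kHomD_mem_cycles C q))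

/-- The inclusion of a syzygy into a term of the Koszul complex. -/
def syzygyι (q : ℕ) : syzygy C (q + 1) ⟶ ModuleCat.of (Alg C) (KHom C q) :=
  ModuleCat.ofHom (cycles C q).subtype

theorem syzygyι_toSyzygy (q : ℕ) : syzygyι C q ≫ toSyzygy C q = 0 := by
  cases q with
  | zero => exact ModuleCat.hom_ext (LinearMap.ext fun z => z.2)
  | succ q => exact ModuleCat.hom_ext (LinearMap.ext fun z => Subtype.ext z.2)

theorem shortExact_syzygy {q : ℕ}
    (hq : ∀ i < q, ∀ z ∈ cycles C i, ∃ h, kHomD C i h = z) :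
    (ShortComplex.mk (syzygyι C q) (toSyzygy C q) (syzygyι_toSyzygy C q)).ShortExact where
  exact := by
    rw [ShortComplex.moduleCat_exact_iff]
    intro x hx
    cases q with
    | zero => exact ⟨⟨x, hx⟩, rfl⟩
    | succ q => exact ⟨⟨x, congrArg Subtype.val hx⟩, rfl⟩
  mono_f := (ModuleCat.mono_iff_injective _).mpr Subtype.val_injective
  epi_g := by
    rw [ModuleCat.epi_iff_surjective]
    cases q with
    | zero => exact kHomAug_surjective C
    | succ q =>
      rintro ⟨z, hz⟩
      obtain ⟨h, rfl⟩ := hq q (Nat.lt_succ_self q) z hz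
      exact ⟨h, rfl⟩

instance (q : ℕ) : Projective (ModuleCat.of (Alg C) (KHom C q)) :=
  (IsProjective.iff_projective _).mp (Module.Projective.of_equiv (toKHom C q))

/-- The syzygies of the trivial module are its iterated kernels in the Koszul complex as long as
the latter is exact, so exactness propagates by induction on the degree. -/
theorem kHomD_exact
    (hExt : ∀ p : ℕ, Nonempty (extFF C p ≃ₗ[F] piece (perp C) p)) (p : ℕ) :
    ∀ z ∈ cycles C p, ∃ h, kHomD C p h = z := by
  induction p using Nat.strong_induction_on with
  | _ p ih =>
  obtain ⟨α, hα⟩ := exists_hom_to_ext (F := F) p (trivialModule C) (syzygy C)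
    (fun q => ModuleCat.of (Alg C) (KHom C q)) (syzygyι C) (toSyzygy C) (syzygyι_toSyzygy C)
    (fun q hq => shortExact_syzygy C fun i hi => ih i (by omega))
    (fun f => ModuleCat.hom_ext (LinearMap.ext fun z => hom_trivial_of_mem_cycles C f.hom z.2))
  obtain ⟨e⟩ := hExt (p + 1)
  exact fun z hz => exists_kHomD_eq_of_injective C α hα e hz

theorem isKoszul_of_ext (hExt : ∀ p : ℕ, Nonempty (extFF C p ≃ₗ[F] piece (perp C) p)) :
    IsKoszul C := by
  have hexact := kHomD_exact C hExt
  have hD : ∀ p x, koszulD C p x = 0 ↔ kHomD C p (toKHom C (p + 1) x) = 0 := fun p x => by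
    rw [← toKHom_koszulD, LinearEquiv.map_eq_zero_iff]
  have hrange : ∀ p x, toKHom C p x ∈ cycles C p ↔ x ∈ Set.range (koszulD C p) := fun p x => by
    constructor
    · intro hx
      obtain ⟨h, hh⟩ := hexact p _ hx
      obtain ⟨y, rfl⟩ := (toKHom C (p + 1)).surjective h
      exact ⟨y, (toKHom C p).injective ((toKHom_koszulD C p y).trans hh)⟩
    · rintro ⟨y, rfl⟩
      rw [toKHom_koszulD]
      exact kHomD_mem_cycles C p _
  refine ⟨fun p x => ?_, fun x => ?_, fun r => ?_⟩
  · rw [hD, ← hrange]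
    rfl
  · rw [← hrange]
    change koszulAug C x = 0 ↔ kHomAug C (toKHom C 0 x) = 0
    rw [kHomAug_toKHom]
    rfl
  · obtain ⟨h, hh⟩ := kHomAug_surjective C r
    obtain ⟨x, rfl⟩ := (toKHom C 0).surjective h
    exact ⟨x, (kHomAug_toKHom C x).symm.trans hh⟩

end

end

end QuadraticAlg

theorem proposition3 {F : Type u} [Field F] {V : Type u} [AddCommGroup V] [Module F V]
    [FiniteDimensional F V] (C : Submodule F (V ⊗[F] V))
    (hExt : ∀ p : ℕ, Nonempty
      (QuadraticAlg.extFF C p ≃ₗ[F] QuadraticAlg.piece (QuadraticAlg.perp C) p)) :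
    QuadraticAlg.IsKoszul C := by
  exact QuadraticAlg.isKoszul_of_ext C hExt
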